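/- Let $\mathbb{Q}$ be the complex quaternion algebra, i.e. the $\mathbb{C}$-algebra with basis $1,e_1,e_2,e_3$ and $e_1^2=e_2^2=e_3^2=-1$, $e_1e_2=-e_2e_1=e_3$, $e_2e_3=-e_3e_2=e_1$, $e_3e_1=-e_1e_3=e_2$. For $a=a_0+a_1e_1+a_2e_2+a_3e_3\in\mathbb{Q}$ with $a_0,\dots,a_3\in\mathbb{C}$ put $$\psi(a)=\begin{pmatrix} a_0+a_1 i & -(a_2+a_3 i)\\ a_2-a_3 i & a_0-a_1 i\end{pmatrix}\in\mathbb{C}^{2\times 2},$$ and for $A=(a_{st})\in\mathbb{Q}^{n\times n}$ let $\psi(A)=(\psi(a_{st}))\in\mathbb{C}^{2n\times 2n}$ be the complex matrix with blocks $\psi(a_{st})$. Theorem 5.2. Let $A\in\mathbb{Q}^{n\times n}$. Then $\psi(A)$ has a Jordan canonical form over $\mathbb{C}$, and for any Jordan canonical form $J$ of $\psi(A)$ the following are equivalent: (i) $A$ is similar over $\mathbb{Q}$ to a diagonal matrix, i.e. there are an invertible $X\in\mathbb{Q}^{n\times n}$ and $\lambda_1,\dots,\lambda_n\in\mathbb{Q}$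 with $X^{-1}AX=\mathrm{diag}(\lambda_1,\dots,\lambda_n)$; (ii) every Jordan block of $J$ has size at most $2$. -/

import Mathlib

/-- The complex quaternion (biquaternion) algebra: quaternions `a₀ + a₁e₁ + a₂e₂ + a₃e₃` with
complex coefficients, `a₀ = a.re`, `a₁ = a.imI`, `a₂ = a.imJ`, `a₃ = a.imK`. -/
abbrev ComplexQuaternion : Type := Quaternion ℂ

namespace ComplexQuaternion

/-- The `2 × 2` complex matrix representation `ψ(a)` of a complex quaternion. -/
def psi (a : ComplexQuaternion) : Matrix (Fin 2) (Fin 2) ℂ :=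
  !![a.re + a.imI * Complex.I, -(a.imJ + a.imK * Complex.I);
     a.imJ - a.imK * Complex.I, a.re - a.imI * Complex.I]

/-- The complex representation `ψ(A) = (ψ(a_{st}))` of a matrix over the complex quaternions: the
`2m × 2n` complex matrix whose `(s, t)` block is `ψ(a_{st})`. The row `2s + p` is indexed by the
pair `(s, p)`. -/
def psiMatrix {m n : ℕ} (A : Matrix (Fin m) (Fin n) ComplexQuaternion) :
    Matrix (Fin m × Fin 2) (Fin n × Fin 2) ℂ :=
  Matrix.of fun x y => psi (A x.1 y.1) x.2 y.2

end ComplexQuaternion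

/-- Two square matrices `A`, `B` over a (possibly noncommutative) ring are similar if
`X⁻¹ A X = B` for some invertible matrix `X` over that ring. -/
def MatrixSimilar {ι R : Type*} [Fintype ι] [DecidableEq ι] [Ring R] (A B : Matrix ι ι R) : Prop :=
  ∃ X : (Matrix ι ι R)ˣ, (↑X⁻¹ : Matrix ι ι R) * A * (X : Matrix ι ι R) = B

/-- The `k × k` Jordan block with eigenvalue `μ`: `μ` on the diagonal, `1` on the superdiagonal. -/
def jordanBlock (k : ℕ) (μ : ℂ) : Matrix (Fin k) (Fin k) ℂ :=
  Matrix.of fun i j => if i = j then μ else if (i : ℕ) + 1 = (j : ℕ) then 1 else 0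

/-- A finite list of nonempty Jordan blocks, given by their sizes and eigenvalues. -/
structure JordanBlocks where
  /-- the number of blocks -/
  count : ℕ
  /-- the size of each block -/
  size : Fin count → ℕ
  /-- every block is nonempty -/
  size_pos : ∀ t, 0 < size t
  /-- the eigenvalue of each block -/
  eigenvalue : Fin count → ℂ

/-- The block diagonal matrix `diag(J₁, …, J_r)` of the listed Jordan blocks. -/
def JordanBlocks.toMatrix (J : JordanBlocks) :
    Matrix (Σ t, Fin (J.size t)) (Σ t, Fin (J.size t)) ℂ :=
  Matrix.blockDiagonal' fun t => jordanBlock (J.size t) (J.eigenvalue t)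

/-- `diag(J₁, …, J_r)` is a Jordan canonical form of the square complex matrix `M`: they are similar
over `ℂ`, after identifying the two index sets by a bijection (which one does not matter, since
permutation matrices are invertible). -/
def JordanBlocks.IsJordanFormOf {ι : Type*} [Fintype ι] [DecidableEq ι] (J : JordanBlocks)
    (M : Matrix ι ι ℂ) : Prop :=
  ∃ e : (Σ t, Fin (J.size t)) ≃ ι, MatrixSimilar M (Matrix.reindex e e J.toMatrix)

section

open ComplexQuaternion Matrix Polynomial

/-! `psi` is a ring isomorphism onto the 2×2 complex matrices, so `psiMatrix` is one onto the 2n×2n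
matrices. Hence `A` is similar to a diagonal matrix iff `psiMatrix A` is similar to a block diagonal
matrix with n blocks of size 2×2. If all Jordan blocks have size at most 2, those of size 2 fill
some of these blocks, and the remaining 1×1 blocks, even in number, pair up
(`exists_sigmaFin_equiv_prod_two`). Conversely, for 2×2 blocks the kernels of (M - μ)^3 and (M -
μ)^2 agree. This property, `Matrix.HasIndexLETwo`, is invariant under similarity and fails for a
Jordan block of size at least 3. -/

/-! ### Existence of Jordan forms, from the structure theorem for torsion ℂ[X]-modules -/

theorem exists_basis_quotient_irreducible_pow {p : ℂ[X]} (hp : Irreducible p) (k : ℕ) :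
    ∃ (μ : ℂ) (b : Module.Basis (Fin k) ℂ (ℂ[X] ⧸ (ℂ[X] ∙ p ^ k))), ∀ j : Fin k,
      (X : ℂ[X]) • b j =
        μ • b j + if h : 0 < (j : ℕ) then b ⟨j - 1, by omega⟩ else 0 := by
  obtain ⟨μ, hμ⟩ := IsAlgClosed.exists_root p (by
    rw [IsAlgClosed.degree_eq_one_of_irreducible ℂ hp]; exact one_ne_zero)
  have hdeg : p.natDegree = 1 :=
    natDegree_eq_of_degree_eq_some (IsAlgClosed.degree_eq_one_of_irreducible ℂ hp)
  have hass : Associated p (X - C μ) :=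
    ((irreducible_X_sub_C μ).associated_of_dvd hp (dvd_iff_isRoot.mpr hμ)).symm
  have hzero : ∀ i, k ≤ i →
      (ℂ[X] ∙ p ^ k).mkQ ((X - C μ) ^ i) = 0 := by
    intro i hi
    rw [Submodule.mkQ_apply, Submodule.Quotient.mk_eq_zero, Submodule.mem_span_singleton]
    obtain ⟨c, hc⟩ := ((hass.pow_pow (n := k)).dvd.trans (pow_dvd_pow (X - C μ) hi))
    exact ⟨c, by rw [hc, smul_eq_mul, mul_comm]⟩
  -- Exponents descend so that X - μ sends each vector to its predecessor and kills the first.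
  -- Taylor expansion at μ shows that they span.
  let v : Fin k → ℂ[X] ⧸ (ℂ[X] ∙ p ^ k) := fun j =>
    (ℂ[X] ∙ p ^ k).mkQ ((X - C μ) ^ (k - 1 - (j : ℕ)))
  have hspan : ⊤ ≤ Submodule.span ℂ (Set.range v) := by
    rintro x -
    obtain ⟨q, rfl⟩ := (ℂ[X] ∙ p ^ k).mkQ_surjective x
    rw [← sum_taylor_eq q μ, Polynomial.sum, map_sum]
    refine Submodule.sum_mem _ fun i _ => ?_
    rw [← smul_eq_C_mul, ← LinearMap.coe_restrictScalars ℂ, map_smul]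
    refine Submodule.smul_mem _ _ ?_
    rw [LinearMap.coe_restrictScalars]
    rcases lt_or_ge i k with hi | hi
    · refine Submodule.subset_span ⟨⟨k - 1 - i, by omega⟩, ?_⟩
      simp only [v]
      congr 2
      omega
    · rw [hzero i hi]; exact Submodule.zero_mem _
  have hcard : Fintype.card (Fin k) = Module.finrank ℂ (ℂ[X] ⧸ (ℂ[X] ∙ p ^ k)) := by
    refine Eq.trans ?_ (finrank_quotient_span_eq_natDegree (f := p ^ k)).symm
    simp [natDegree_pow, hdeg]
  have : Module.Finite ℂ (ℂ[X] ⧸ (ℂ[X] ∙ p ^ k)) :=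
    Module.Finite.of_basis (Module.Basis.mk
      (linearIndependent_of_top_le_span_of_card_eq_finrank hspan hcard) hspan)
  refine ⟨μ, basisOfTopLeSpanOfCardEqFinrank v hspan hcard, fun j => ?_⟩
  rw [coe_basisOfTopLeSpanOfCardEqFinrank]
  have hX : (X : ℂ[X]) * (X - C μ) ^ (k - 1 - (j : ℕ)) =
      μ • (X - C μ) ^ (k - 1 - (j : ℕ)) + (X - C μ) ^ (k - 1 - (j : ℕ) + 1) := by
    rw [smul_eq_C_mul]; ring
  have hv : (X : ℂ[X]) • v j =
      μ • v j + (ℂ[X] ∙ p ^ k).mkQ ((X - C μ) ^ (k - 1 - (j : ℕ) + 1)) := by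
    simp only [v]
    rw [← map_smul, smul_eq_mul, hX, map_add]
    rfl
  rw [hv]
  congr 1
  split_ifs with h
  · simp only [v]
    congr 2
    omega
  · exact hzero _ (by omega)

/-- Every endomorphism of a finite-dimensional complex space has a Jordan basis. -/
theorem exists_jordan_basis {V : Type*} [AddCommGroup V] [Module ℂ V] [FiniteDimensional ℂ V]
    (f : V →ₗ[ℂ] V) :
    ∃ (J : JordanBlocks) (b : Module.Basis (Σ t, Fin (J.size t)) ℂ V), ∀ t (j : Fin (J.size t)),
      f (b ⟨t, j⟩) = J.eigenvalue t • b ⟨t, j⟩ +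
        if h : 0 < (j : ℕ) then b ⟨t, ⟨j - 1, by omega⟩⟩ else 0 := by
  classical
  obtain ⟨ι, _, p, hp, k, ⟨E⟩⟩ := Module.equiv_directSum_of_isTorsion
    (Module.AEval.isTorsion_of_finiteDimensional ℂ V f)
  choose μ b hb using fun i => exists_basis_quotient_irreducible_pow (hp i) (k i)
  let F := E.trans (DirectSum.linearEquivFunOnFintype ℂ[X] ι _)
  let B : Module.Basis (Σ i, Fin (k i)) ℂ V := (Pi.basis b).map
    ((F.restrictScalars ℂ).symm.trans (Module.AEval'.of f).symm)
  have hB : ∀ i (j : Fin (k i)), f (B ⟨i, j⟩) = μ i • B ⟨i, j⟩ +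
      if h : 0 < (j : ℕ) then B ⟨i, ⟨j - 1, by omega⟩⟩ else 0 := by
    intro i j
    have hBv : ∀ (l : Fin (k i)), B ⟨i, l⟩ =
        (Module.AEval'.of f).symm (F.symm (Pi.single i (b i l))) := by
      intro l; simp [B, Pi.basis_apply]
    have hfB : f (B ⟨i, j⟩) =
        (Module.AEval'.of f).symm (F.symm (Pi.single i ((X : ℂ[X]) • b i j))) := by
      rw [hBv, Pi.single_smul, map_smul]
      exact (Module.AEval.of_symm_X_smul f _).symm
    have hsm : ∀ x, (Module.AEval'.of f).symm (F.symm (Pi.single i (μ i • x))) =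
        μ i • (Module.AEval'.of f).symm (F.symm (Pi.single i x)) := by
      intro x
      rw [Pi.single_smul, ← map_smul]
      exact congrArg _ ((F.restrictScalars ℂ).symm.map_smul _ _)
    rw [hfB, hb, Pi.single_add, map_add, map_add, hsm, ← hBv]
    congr 1
    split_ifs with h
    · rw [hBv]
    · simp
  -- The structure theorem allows exponent 0, a zero summand; these would be empty blocks and are
  -- dropped.
  let ε := Fintype.equivFin {i // 0 < k i}
  let σ : (Σ t : Fin (Fintype.card {i // 0 < k i}), Fin (k (ε.symm t).1)) ≃ Σ i, Fin (k i) :=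
    { toFun := fun x => ⟨(ε.symm x.1).1, x.2⟩
      invFun := fun x => ⟨ε ⟨x.1, x.2.pos⟩, Fin.cast (by simp) x.2⟩
      left_inv := by
        rintro ⟨t, j⟩
        refine Sigma.ext (by simp) ?_
        exact (Fin.heq_ext_iff (by simp)).2 rfl
      right_inv := by
        rintro ⟨i, j⟩
        refine Sigma.ext (by simp) ?_
        exact (Fin.heq_ext_iff (by simp)).2 rfl }
  refine ⟨⟨_, fun t => k (ε.symm t).1, fun t => (ε.symm t).2, fun t => μ (ε.symm t).1⟩,
    B.reindex σ.symm, fun t j => ?_⟩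
  simpa [σ] using hB (ε.symm t).1 j

theorem exists_isJordanFormOf {ι : Type*} [Fintype ι] [DecidableEq ι] (M : Matrix ι ι ℂ) :
    ∃ J : JordanBlocks, J.IsJordanFormOf M := by
  obtain ⟨J, b, hb⟩ := exists_jordan_basis (Matrix.toLin' M)
  let e := b.indexEquiv (Pi.basisFun ℂ ι)
  let c := b.reindex e
  refine ⟨J, e, ⟨⟨(Pi.basisFun ℂ ι).toMatrix c, c.toMatrix (Pi.basisFun ℂ ι),
    Module.Basis.toMatrix_mul_toMatrix_flip _ _, Module.Basis.toMatrix_mul_toMatrix_flip _ _⟩, ?_⟩⟩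
  have hM : M = LinearMap.toMatrix (Pi.basisFun ℂ ι) (Pi.basisFun ℂ ι) (Matrix.toLin' M) := by
    rw [LinearMap.toMatrix_eq_toMatrix', LinearMap.toMatrix'_toLin']
  change c.toMatrix (Pi.basisFun ℂ ι) * M * (Pi.basisFun ℂ ι).toMatrix c = _
  conv_lhs => rw [hM, basis_toMatrix_mul_linearMap_toMatrix_mul_basis_toMatrix]
  ext x y
  obtain ⟨⟨s, i⟩, rfl⟩ := e.surjective x
  obtain ⟨⟨t, j⟩, rfl⟩ := e.surjective y
  rw [LinearMap.toMatrix_apply]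
  simp only [c, Module.Basis.reindex_apply, Equiv.symm_apply_apply, hb,
    Module.Basis.repr_reindex_apply, Matrix.reindex_apply, Matrix.submatrix_apply,
    JordanBlocks.toMatrix]
  by_cases hst : s = t
  · subst hst
    rw [blockDiagonal'_apply_eq]
    simp only [jordanBlock, of_apply]
    split_ifs with h1 h2 h3 <;> simp [Finsupp.single_apply, Fin.ext_iff] <;> grind
  · rw [blockDiagonal'_apply_ne _ _ _ hst]
    split_ifs with h1 <;> simp [Ne.symm hst]

/-! ### Similarity and the isomorphism with complex matrices -/

namespace MatrixSimilar

variable {ι κ R S : Type*} [Fintype ι] [DecidableEq ι] [Fintype κ] [DecidableEq κ]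
  [Ring R] [Ring S]

theorem symm {A B : Matrix ι ι R} (h : MatrixSimilar A B) : MatrixSimilar B A := by
  obtain ⟨X, rfl⟩ := h
  exact ⟨X⁻¹, by simp [mul_assoc]⟩

theorem trans {A B C : Matrix ι ι R} (h : MatrixSimilar A B) (h' : MatrixSimilar B C) :
    MatrixSimilar A C := by
  obtain ⟨X, rfl⟩ := h
  obtain ⟨Y, rfl⟩ := h'
  exact ⟨X * Y, by simp [mul_assoc]⟩

theorem map {A B : Matrix ι ι R} (h : MatrixSimilar A B)
    (f : Matrix ι ι R →+* Matrix κ κ S) : MatrixSimilar (f A) (f B) := by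
  obtain ⟨X, rfl⟩ := h
  exact ⟨Units.map f.toMonoidHom X, by simp [← map_inv]⟩

theorem reindex_perm (A : Matrix ι ι R) (σ : Equiv.Perm ι) :
    MatrixSimilar A (Matrix.reindex σ σ A) := by
  refine ⟨⟨(σ.toPEquiv.toMatrix : Matrix ι ι R), σ.symm.toPEquiv.toMatrix, ?_, ?_⟩, ?_⟩
  · rw [← PEquiv.toMatrix_trans, ← Equiv.toPEquiv_trans]; simp
  · rw [← PEquiv.toMatrix_trans, ← Equiv.toPEquiv_trans]; simp
  · change σ.symm.toPEquiv.toMatrix * A * σ.toPEquiv.toMatrix = _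
    rw [PEquiv.toMatrix_toPEquiv_mul, PEquiv.mul_toMatrix_toPEquiv]
    rfl

end MatrixSimilar

namespace ComplexQuaternion

/-- The representation `psi` as a ring isomorphism onto the `2 × 2` complex matrices. -/
noncomputable def psiEquiv : ComplexQuaternion ≃+* Matrix (Fin 2) (Fin 2) ℂ where
  toFun := psi
  invFun M := ⟨(M 0 0 + M 1 1) / 2, (M 0 0 - M 1 1) / (2 * Complex.I), (M 1 0 - M 0 1) / 2,
    -(M 0 1 + M 1 0) / (2 * Complex.I)⟩
  left_inv a := by
    ext <;> simp [psi] <;> field_simp <;> ring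
  right_inv M := by
    ext i j
    fin_cases i <;> fin_cases j <;> simp [psi] <;> field_simp <;> ring
  map_mul' a b := by
    ext i j
    fin_cases i <;> fin_cases j <;> simp [psi] <;> ring_nf <;> simp <;> ring
  map_add' a b := by
    ext i j
    fin_cases i <;> fin_cases j <;> simp [psi] <;> ring

/-- The representation `psiMatrix` as a ring isomorphism. -/
noncomputable def psiMatrixEquiv (n : ℕ) :
    Matrix (Fin n) (Fin n) ComplexQuaternion ≃+* Matrix (Fin n × Fin 2) (Fin n × Fin 2) ℂ :=
  psiEquiv.mapMatrix.trans (Matrix.compRingEquiv (Fin n) (Fin 2) ℂ)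

theorem psiMatrixEquiv_apply {n : ℕ} (A : Matrix (Fin n) (Fin n) ComplexQuaternion) :
    psiMatrixEquiv n A = psiMatrix A := rfl

theorem exists_psiMatrix_diagonal_eq {n : ℕ} {M : Matrix (Fin n × Fin 2) (Fin n × Fin 2) ℂ}
    (hM : ∀ x y, x.1 ≠ y.1 → M x y = 0) :
    ∃ d : Fin n → ComplexQuaternion, psiMatrix (Matrix.diagonal d) = M := by
  refine ⟨fun s => psiEquiv.symm (Matrix.of fun p q => M (s, p) (s, q)), ?_⟩
  ext ⟨s, p⟩ ⟨t, q⟩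
  by_cases hst : s = t
  · subst hst
    change psiEquiv _ p q = _
    simp
  · change psiEquiv _ p q = _
    simp [hst, hM (s, p) (t, q) hst]

end ComplexQuaternion

/-! ### Diagonalizability bounds the block sizes -/

/-- Cayley–Hamilton: a singular N satisfies N² = tr(N) N, so N³B = tr(N) N²B, and tr(N) = 0 forces
N² = 0. An invertible N forces B = 0. -/
theorem Matrix.sq_mul_eq_zero_of_pow_three_mul_eq_zero {K : Type*} [Field K]
    {N B : Matrix (Fin 2) (Fin 2) K} (h : N ^ 3 * B = 0) : N ^ 2 * B = 0 := by
  have hc : N ^ 2 = N.trace • N - N.det • 1 := by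
    ext i j
    fin_cases i <;> fin_cases j <;>
      simp [pow_two, Matrix.mul_apply, Matrix.trace_fin_two, Matrix.det_fin_two] <;> ring
  by_cases hd : N.det = 0
  · rw [hd, zero_smul, sub_zero] at hc
    have h3 : N ^ 3 * B = N.trace • (N ^ 2 * B) := by
      rw [pow_succ, hc, Matrix.smul_mul, Matrix.smul_mul, ← pow_two, Matrix.smul_mul, hc,
        Matrix.smul_mul]
    rw [h3, smul_eq_zero] at h
    rcases h with h | h
    · rw [hc, h, zero_smul, zero_mul]
    · exact h
  · have hu : IsUnit N := (Matrix.isUnit_iff_isUnit_det N).mpr (isUnit_iff_ne_zero.mpr hd)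
    have : B = 0 := (hu.pow 3).mul_right_eq_zero.mp h
    rw [this, mul_zero]

/-- No generalized eigenvector of `M` has order three or more. -/
def Matrix.HasIndexLETwo {ι : Type*} [Fintype ι] [DecidableEq ι] (M : Matrix ι ι ℂ) : Prop :=
  ∀ (μ : ℂ) (B : Matrix ι ι ℂ),
    (M - algebraMap ℂ _ μ) ^ 3 * B = 0 → (M - algebraMap ℂ _ μ) ^ 2 * B = 0

namespace Matrix.HasIndexLETwo

variable {ι κ : Type*} [Fintype ι] [DecidableEq ι] [Fintype κ] [DecidableEq κ]

theorem map {M : Matrix ι ι ℂ} (h : M.HasIndexLETwo)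
    (f : Matrix ι ι ℂ ≃ₐ[ℂ] Matrix κ κ ℂ) : (f M).HasIndexLETwo := by
  intro μ B hB
  have hf : f M - algebraMap ℂ _ μ = f (M - algebraMap ℂ _ μ) := by
    rw [map_sub, AlgEquiv.commutes]
  obtain ⟨B, rfl⟩ := f.surjective B
  rw [hf, ← map_pow, ← map_mul] at hB ⊢
  rw [h μ B ((map_eq_zero_iff f f.injective).mp hB), map_zero]

theorem of_similar {M M' : Matrix ι ι ℂ} (h : M.HasIndexLETwo) (hs : MatrixSimilar M M') :
    M'.HasIndexLETwo := by
  obtain ⟨X, rfl⟩ := hs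
  intro μ B hB
  have hc : (↑X⁻¹ : Matrix ι ι ℂ) * M * X - algebraMap ℂ _ μ =
      (↑X⁻¹ : Matrix ι ι ℂ) * (M - algebraMap ℂ _ μ) * X := by
    rw [mul_sub, sub_mul, ← Algebra.commutes μ, mul_assoc (algebraMap ℂ _ μ), Units.inv_mul,
      mul_one]
  rw [hc, Units.conj_pow', mul_assoc, mul_assoc, Units.mul_right_eq_zero] at hB ⊢
  exact h μ _ hB

end Matrix.HasIndexLETwo

theorem ComplexQuaternion.hasIndexLETwo_psiMatrix_diagonal {n : ℕ}
    (d : Fin n → ComplexQuaternion) : (psiMatrix (Matrix.diagonal d)).HasIndexLETwo := by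
  intro μ B hB
  let c := Matrix.compAlgEquiv (Fin n) (Fin 2) ℂ ℂ
  obtain ⟨B, rfl⟩ := c.surjective B
  have hd : psiMatrix (Matrix.diagonal d) - algebraMap ℂ _ μ =
      c (Matrix.diagonal fun s => psiEquiv (d s) - algebraMap ℂ _ μ) := by
    rw [← psiMatrixEquiv_apply, ← c.commutes]
    change c (psiEquiv.mapMatrix _) - _ = _
    rw [← map_sub]
    congr 1
    ext s t : 1
    by_cases hst : s = t
    · subst hst; simp [Matrix.algebraMap_matrix_apply]
    · simp [hst, Matrix.algebraMap_matrix_apply]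
  rw [hd, ← map_pow, ← map_mul, Matrix.diagonal_pow] at hB ⊢
  rw [map_eq_zero_iff c c.injective] at hB ⊢
  refine Matrix.ext fun s t => ?_
  have := congrFun (congrFun hB s) t
  rw [Matrix.diagonal_mul] at this ⊢
  exact Matrix.sq_mul_eq_zero_of_pow_three_mul_eq_zero this

theorem JordanBlocks.size_le_two_of_hasIndexLETwo {J : JordanBlocks}
    (h : J.toMatrix.HasIndexLETwo) (t : Fin J.count) : J.size t ≤ 2 := by
  by_contra! hk
  let i₀ : Fin (J.size t) := ⟨0, by omega⟩
  let i₁ : Fin (J.size t) := ⟨1, by omega⟩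
  let i₂ : Fin (J.size t) := ⟨2, by omega⟩
  -- Basis vectors of the block, stored as single columns: N shifts E i₂ to E i₁ to E i₀ to 0, so N³
  -- kills E i₂ but N² does not.
  let E : Fin (J.size t) → Matrix (Σ t, Fin (J.size t)) (Σ t, Fin (J.size t)) ℂ :=
    fun j => Matrix.single ⟨t, j⟩ ⟨t, i₂⟩ 1
  let N := J.toMatrix - algebraMap ℂ _ (J.eigenvalue t)
  have hN : ∀ x j, N x ⟨t, j⟩ = if x.1 = t ∧ (x.2 : ℕ) + 1 = j then 1 else 0 := by
    rintro ⟨s, i⟩ j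
    by_cases hst : s = t
    · subst hst
      simp only [N, JordanBlocks.toMatrix, Matrix.sub_apply, Matrix.blockDiagonal'_apply_eq,
        jordanBlock, Matrix.of_apply, Matrix.algebraMap_matrix_apply]
      by_cases hij : i = j
      · simp [hij]
      · simp [hij]
    · simp [N, JordanBlocks.toMatrix, Matrix.blockDiagonal'_apply_ne _ _ _ hst,
        Matrix.algebraMap_matrix_apply, hst]
  have hE : ∀ j x y, (N * E j) x y = if y = ⟨t, i₂⟩ then N x ⟨t, j⟩ else 0 := by
    intro j x y
    split_ifs with hy
    · subst hy; simp [E]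
    · simp [E, Matrix.mul_single_apply_of_ne _ _ _ _ _ hy]
  have hstep : ∀ i j : Fin (J.size t), (i : ℕ) + 1 = j → N * E j = E i := by
    intro i j hij
    ext x y
    rw [hE, hN]
    obtain ⟨s, k⟩ := x
    by_cases hs : s = t
    · subst hs
      simp only [E, Matrix.single_apply, Sigma.mk.injEq, heq_eq_eq, true_and, ← hij]
      grind
    · simp [E, hs, Ne.symm hs]
  have h₀ : N * E i₀ = 0 := by
    ext x y
    rw [hE, hN]
    simp [i₀]
  have h2 : N ^ 2 * E i₂ = E i₀ := by
    rw [pow_two, mul_assoc, hstep i₁ i₂ rfl, hstep i₀ i₁ rfl]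
  have h3 : N ^ 3 * E i₂ = 0 := by
    rw [pow_succ', mul_assoc, h2, h₀]
  have h0 := congrFun (congrFun (h _ _ h3) ⟨t, i₀⟩) ⟨t, i₂⟩
  rw [show (J.toMatrix - algebraMap ℂ _ (J.eigenvalue t)) ^ 2 * E i₂ = E i₀ from h2] at h0
  simp [E] at h0

/-! ### Small blocks give a diagonal form -/

/-- A family of sets with at most two elements each and `2 n` elements in all can be distributed
over `n` boxes with two places each without splitting any of the sets. -/
theorem exists_sigmaFin_equiv_prod_two {r n : ℕ} {k : Fin r → ℕ}
    (hk : ∀ t, k t ≤ 2) (hcard : Fintype.card (Σ t, Fin (k t)) = n * 2) :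
    ∃ f : (Σ t, Fin (k t)) ≃ Fin n × Fin 2, ∀ t i j, (f ⟨t, i⟩).1 = (f ⟨t, j⟩).1 := by
  classical
  let P : (Σ t, Fin (k t)) → Prop := fun x => k x.1 = 2
  let g₂ : {x : Σ t, Fin (k t) // P x} ≃ {t // k t = 2} × Fin 2 :=
    { toFun := fun x => (⟨x.1.1, x.2⟩, Fin.cast x.2 x.1.2)
      invFun := fun y => ⟨⟨y.1.1, Fin.cast y.1.2.symm y.2⟩, y.1.2⟩
      left_inv := fun x => by simp
      right_inv := fun y => by simp }
  have hsum := Fintype.card_subtype_compl P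
  have h₂ := Fintype.card_congr g₂
  have hle := Fintype.card_subtype_le P
  rw [Fintype.card_prod, Fintype.card_fin] at h₂
  let m := n - Fintype.card {t // k t = 2}
  -- The leftover sets have at most one element, so any bijection avoids splitting them.
  have g₁ : {x : Σ t, Fin (k t) // ¬ P x} ≃ Fin m × Fin 2 :=
    Fintype.equivOfCardEq (by
      rw [hsum, Fintype.card_prod, Fintype.card_fin, Fintype.card_fin]; omega)
  have gn : {t // k t = 2} ⊕ Fin m ≃ Fin n :=
    Fintype.equivOfCardEq (by rw [Fintype.card_sum, Fintype.card_fin, Fintype.card_fin]; omega)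
  let f := ((Equiv.sumCompl P).symm.trans ((g₂.sumCongr g₁).trans
    (Equiv.sumProdDistrib _ _ _).symm)).trans (gn.prodCongr (Equiv.refl (Fin 2)))
  refine ⟨f, fun t i j => ?_⟩
  by_cases ht : k t = 2
  · have hf : ∀ i, (f ⟨t, i⟩).1 = gn (Sum.inl ⟨t, ht⟩) := by
      intro i
      simp [f, Equiv.sumCompl_symm_apply_of_pos (p := P) (a := ⟨t, i⟩) ht, g₂]
    rw [hf, hf]
  · have : i = j := by
      ext
      have := hk t
      omega
    rw [this]

theorem JordanBlocks.IsJordanFormOf.exists_similar_diagonal {n : ℕ}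
    {A : Matrix (Fin n) (Fin n) ComplexQuaternion} {J : JordanBlocks}
    (hJ : J.IsJordanFormOf (psiMatrix A)) (hk : ∀ t, J.size t ≤ 2) :
    ∃ d : Fin n → ComplexQuaternion, MatrixSimilar A (Matrix.diagonal d) := by
  obtain ⟨e, he⟩ := hJ
  obtain ⟨f, hf⟩ := exists_sigmaFin_equiv_prod_two hk
    (by rw [Fintype.card_congr e, Fintype.card_prod, Fintype.card_fin, Fintype.card_fin])
  -- The given `e` may split Jordan blocks across boxes; a permutation replaces it by `f`.
  have hef : MatrixSimilar (psiMatrix A) (Matrix.reindex f f J.toMatrix) := by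
    refine he.trans ?_
    convert MatrixSimilar.reindex_perm (Matrix.reindex e e J.toMatrix) (e.symm.trans f) using 1
    ext x y
    simp
  obtain ⟨d, hd⟩ := exists_psiMatrix_diagonal_eq (M := Matrix.reindex f f J.toMatrix) (by
    intro x y hxy
    obtain ⟨⟨s, i⟩, rfl⟩ := f.surjective x
    obtain ⟨⟨t, j⟩, rfl⟩ := f.surjective y
    have hst : s ≠ t := by
      rintro rfl
      exact hxy (hf s i j)
    simp [JordanBlocks.toMatrix, Matrix.blockDiagonal'_apply_ne _ _ _ hst])
  refine ⟨d, ?_⟩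
  rw [← hd] at hef
  have := hef.map (psiMatrixEquiv n).symm.toRingHom
  simpa [← psiMatrixEquiv_apply] using this

theorem JordanBlocks.IsJordanFormOf.size_le_two_of_similar_diagonal {n : ℕ}
    {A : Matrix (Fin n) (Fin n) ComplexQuaternion} {J : JordanBlocks}
    (hJ : J.IsJordanFormOf (psiMatrix A)) {d : Fin n → ComplexQuaternion}
    (hd : MatrixSimilar A (Matrix.diagonal d)) (t : Fin J.count) : J.size t ≤ 2 := by
  obtain ⟨e, he⟩ := hJ
  have hs := (hd.map (psiMatrixEquiv n).toRingHom).symm.trans he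
  refine JordanBlocks.size_le_two_of_hasIndexLETwo ?_ t
  have h := (hasIndexLETwo_psiMatrix_diagonal d).of_similar hs
  convert h.map (Matrix.reindexAlgEquiv ℂ ℂ e.symm)
  ext x y
  simp

end

theorem theorem5p2 (n : ℕ) (A : Matrix (Fin n) (Fin n) ComplexQuaternion) :
    (∃ J : JordanBlocks, J.IsJordanFormOf (ComplexQuaternion.psiMatrix A)) ∧
    ∀ J : JordanBlocks, J.IsJordanFormOf (ComplexQuaternion.psiMatrix A) →
      ((∃ d : Fin n → ComplexQuaternion, MatrixSimilar A (Matrix.diagonal d)) ↔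
        ∀ t : Fin J.count, J.size t ≤ 2) := by
  refine ⟨exists_isJordanFormOf _, fun J hJ => ⟨?_, hJ.exists_similar_diagonal⟩⟩
  rintro ⟨d, hd⟩
  exact hJ.size_le_two_of_similar_diagonal hd
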